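/- Let $\Bbbk$ be a field, let $A,B,C$ be pairwise disjoint finite sets and let $B_0\subseteq B$. A simplicial complex on a finite vertex set $W$ is a nonempty family of subsets of $W$ (the faces) closed under taking subsets; the elements of $W$ need not be faces. Its Stanley--Reisner ideal is generated by the squarefree monomials $x_F=\prod_{v\in F}x_v$ with $F\subseteq W$ not a face. Let $X_{AB}$ be a simplicial complex on $A\cup B$ with Stanley--Reisner ideal $I_{AB}$, and let $X_{B_0C}$ be a simplicial complex on $B_0\cup C$ with Stanley--Reisner ideal $I_{B_0C}$. Assume that no minimal generator of $I_{AB}$ or of $I_{B_0C}$ is divisible by a monomial $x_{b_1}x_{b_2}$ with $b_1,b_2\in B$. Let $X$ be the simplicial complex on $A\cup B\cup C$ whose Stanley--Reisner ideal (in the polynomial ring over $\Bbbk$ in the variables indexed by $A\cup B\cup C$) is generated by the following monomials: 1. $x_{\mathbf a}\in I_{AB}$ with $\mathbf a\subseteq A$; 2. $x_{\mathbf c}\in I_{B_0C}$ with $\mathbf c\subseteq C$; 3. $x_{\mathbf a}x_bx_{\mathbf c}$ with $\mathbf a\subseteq A$, $b\in B_0$, $\mathbf c\subseteq C$ such that $x_{\mathbf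 a}x_b\in I_{AB}$ and $x_bx_{\mathbf c}\in I_{B_0C}$; 4. $x_{\mathbf a}x_b\in I_{AB}$ with $\mathbf a\subseteq A$ and $b\in B\setminus B_0$. Then the join $X_{AB}\ast X_{B_0C}$, formed on the disjoint union of the vertex sets $A\cup B$ and $B_0\cup C$, is homotopy equivalent to $X$ (that is, their geometric realizations are homotopy equivalent). -/

import Mathlib

open MvPolynomial
open scoped ContinuousMap

noncomputable section

namespace TowerJoin

/-- The complex `K` is a simplicial complex on the vertex set `W`: all its faces are subsets of
`W`.  Elements of `W` need not be faces.  In Mathlib's `PreAbstractSimplicialComplex` the empty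
face is left implicit: `faces` lists the nonempty faces, so a complex without members is the
irrelevant complex `{∅}`. -/
def IsOn {V : Type*} (K : PreAbstractSimplicialComplex V) (W : Finset V) : Prop :=
  ∀ F ∈ K.faces, F ⊆ W

/-- The squarefree monomial `x_F = ∏_{v ∈ F} x_v`. -/
def sqfreeMonomial (k : Type*) [CommSemiring k] {V : Type*} (F : Finset V) : MvPolynomial V k :=
  ∏ v ∈ F, X v

/-- The Stanley–Reisner ideal of a simplicial complex `K` on the vertex set `W`: the ideal
generated by the squarefree monomials `x_F` of the nonfaces `F ⊆ W` (the empty set is a face).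
All ideals are taken in one polynomial ring that contains the variables of all vertex sets. -/
def stanleyReisnerIdeal (k : Type*) [CommSemiring k] {V : Type*}
    (K : PreAbstractSimplicialComplex V) (W : Finset V) : Ideal (MvPolynomial V k) :=
  Ideal.span {p | ∃ F : Finset V, F ⊆ W ∧ F.Nonempty ∧ F ∉ K.faces ∧ p = sqfreeMonomial k F}

/-- The monomial `x^m` is a minimal generator of the monomial ideal `I`: it lies in `I` and no
proper divisor of it among the monomials does. -/
def IsMinimalGenerator {k : Type*} [CommSemiring k] {V : Type*}
    (I : Ideal (MvPolynomial V k)) (m : V →₀ ℕ) : Prop :=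
  Minimal (fun m' : V →₀ ℕ => monomial m' (1 : k) ∈ I) m

/-- The monomials generating the Stanley–Reisner ideal of the glued complex, for ideals `I`
(in the variables of `A ∪ B`) and `J` (in the variables of `B₀ ∪ C`). -/
def gluedGenerators (k : Type*) [CommSemiring k] {V : Type*} [DecidableEq V]
    (A B B₀ C : Finset V) (I J : Ideal (MvPolynomial V k)) : Set (MvPolynomial V k) :=
  {p | ∃ a ⊆ A, sqfreeMonomial k a ∈ I ∧ p = sqfreeMonomial k a} ∪
  {p | ∃ c ⊆ C, sqfreeMonomial k c ∈ J ∧ p = sqfreeMonomial k c} ∪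
  {p | ∃ a ⊆ A, ∃ b ∈ B₀, ∃ c ⊆ C,
    sqfreeMonomial k a * X b ∈ I ∧ X b * sqfreeMonomial k c ∈ J ∧
      p = sqfreeMonomial k a * X b * sqfreeMonomial k c} ∪
  {p | ∃ a ⊆ A, ∃ b ∈ B \ B₀,
    sqfreeMonomial k a * X b ∈ I ∧ p = sqfreeMonomial k a * X b}

/-- The join `K * L` of simplicial complexes, on the disjoint union of the vertex types: its faces
are the disjoint unions of a (possibly empty) face of `K` and a (possibly empty) face of `L`. -/
def join {V W : Type*} (K : PreAbstractSimplicialComplex V)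
    (L : PreAbstractSimplicialComplex W) : PreAbstractSimplicialComplex (V ⊕ W) where
  faces := {S | S.Nonempty ∧ (S.toLeft = ∅ ∨ S.toLeft ∈ K.faces) ∧
    (S.toRight = ∅ ∨ S.toRight ∈ L.faces)}
  isRelLowerSet_faces := by
    rintro S ⟨hS, hl, hr⟩
    refine ⟨hS, fun T hTS hT => ⟨hT, ?_, ?_⟩⟩
    · have h : T.toLeft ⊆ S.toLeft := Finset.toLeft_subset_toLeft hTS
      rcases T.toLeft.eq_empty_or_nonempty with h0 | h0
      · exact Or.inl h0
      · rcases hl with hl | hl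
        · exact Or.inl (Finset.subset_empty.1 (hl ▸ h))
        · exact Or.inr ((K.isRelLowerSet_faces hl).2 h h0)
    · have h : T.toRight ⊆ S.toRight := Finset.toRight_subset_toRight hTS
      rcases T.toRight.eq_empty_or_nonempty with h0 | h0
      · exact Or.inl h0
      · rcases hr with hr | hr
        · exact Or.inl (Finset.subset_empty.1 (hr ▸ h))
        · exact Or.inr ((L.isRelLowerSet_faces hr).2 h h0)

/-- The geometric realization of a finite simplicial complex, in barycentric coordinates: the
points of the standard simplex whose support is a face, with the topology induced from `ℝ^V`. -/
def realization {V : Type*} [Fintype V] (K : PreAbstractSimplicialComplex V) : Set (V → ℝ) :=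
  {w | w ∈ stdSimplex ℝ V ∧ ∃ F ∈ K.faces, ∀ v, w v ≠ 0 ↔ v ∈ F}

end TowerJoin

end

noncomputable section

namespace TowerJoin

/-! ### Stanley–Reisner ideals and vertexwise descriptions of faces. -/

section Algebra

variable {k : Type*} [Field k] {V : Type*}

/-! No minimal nonface of either complex contains two vertices of `B`. Hence a nonempty set `F` of
vertices is a face of `X_{AB}` exactly when `F ∩ A` together with any single `v ∈ F` is a face;
likewise for `X_{B₀C}` with `C` in place of `A`. Write `P v F` and `Q v F` for these two tests at
`v`. Both are inherited by smaller `F`. The generators of the glued ideal say that `F` is a face of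
`X` iff every `v ∈ F` passes `P` or `Q` (`mem_glued_faces_iff`). A face of the join distributes the
vertices of such an `F` over two copies, a vertex entering the left copy only if it passes `P` and
the right copy only if it passes `Q` (`mem_join_faces_iff`).

The rest is formal (`nonempty_homotopyEquiv_of_split`). Adding the weights of the two copies maps
the join to `X`. The fibre over a point with support `F` is a nonempty product of points and
intervals, since each vertex may split its weight freely, or must send it all to one side. The
constraints tighten when the support grows, so a continuous section need not be available directly.
Cutting off small coordinates first turns the constraints into closed conditions, and Urysohn
functions then choose the splitting. All homotopies are straight-line. -/

theorem sqfreeMonomial_eq_monomial (F : Finset V) :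
    sqfreeMonomial k F = monomial (∑ v ∈ F, Finsupp.single v 1) 1 := by
  rw [monomial_sum_one]; rfl

theorem sum_single_apply [DecidableEq V] (F : Finset V) (v : V) :
    (∑ w ∈ F, Finsupp.single w 1 : V →₀ ℕ) v = if v ∈ F then 1 else 0 := by
  simp [Finsupp.finsetSum_apply, Finsupp.single_apply]

theorem sum_single_le_iff (F : Finset V) (m : V →₀ ℕ) :
    (∑ w ∈ F, Finsupp.single w 1 : V →₀ ℕ) ≤ m ↔ ∀ v ∈ F, m v ≠ 0 := by
  classical
  rw [Finsupp.le_def]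
  refine forall_congr' fun v => ?_
  rw [sum_single_apply]
  split_ifs with h
  · simp [h, Nat.one_le_iff_ne_zero]
  · simp [h]

theorem monomial_mem_span_sqfreeMonomial_iff (S : Set (Finset V)) (m : V →₀ ℕ) :
    monomial m (1 : k) ∈ Ideal.span (sqfreeMonomial k '' S) ↔
      ∃ G ∈ S, ∀ v ∈ G, m v ≠ 0 := by
  classical
  have h : sqfreeMonomial k '' S = (fun s => monomial s (1 : k)) ''
      ((fun F : Finset V => (∑ v ∈ F, Finsupp.single v 1 : V →₀ ℕ)) '' S) := by
    rw [Set.image_image]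
    exact Set.image_congr fun F _ => sqfreeMonomial_eq_monomial F
  rw [h, mem_ideal_span_monomial_image, support_monomial, if_neg one_ne_zero]
  simp [sum_single_le_iff]

theorem sqfreeMonomial_mem_span_iff (S : Set (Finset V)) (F : Finset V) :
    sqfreeMonomial k F ∈ Ideal.span (sqfreeMonomial k '' S) ↔ ∃ G ∈ S, G ⊆ F := by
  classical
  rw [sqfreeMonomial_eq_monomial, monomial_mem_span_sqfreeMonomial_iff]
  simp only [sum_single_apply, Finset.subset_iff]
  simp

theorem stanleyReisnerIdeal_eq_span (K : PreAbstractSimplicialComplex V) (W : Finset V) :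
    stanleyReisnerIdeal k K W =
      Ideal.span (sqfreeMonomial k '' {F | F ⊆ W ∧ F.Nonempty ∧ F ∉ K.faces}) := by
  unfold stanleyReisnerIdeal
  congr 1
  ext p
  constructor
  · rintro ⟨F, h1, h2, h3, rfl⟩
    exact ⟨F, ⟨h1, h2, h3⟩, rfl⟩
  · rintro ⟨F, ⟨h1, h2, h3⟩, rfl⟩
    exact ⟨F, h1, h2, h3, rfl⟩

theorem face_of_subset {K : PreAbstractSimplicialComplex V} {F G : Finset V} (hF : F ∈ K.faces)
    (hGF : G ⊆ F) (hG : G.Nonempty) : G ∈ K.faces :=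
  (K.isRelLowerSet_faces hF).2 hGF hG

theorem face_nonempty {K : PreAbstractSimplicialComplex V} {F : Finset V} (hF : F ∈ K.faces) :
    F.Nonempty :=
  (K.isRelLowerSet_faces hF).1

theorem sqfreeMonomial_mem_stanleyReisnerIdeal_iff (K : PreAbstractSimplicialComplex V)
    {W F : Finset V} (hF : F ⊆ W) :
    sqfreeMonomial k F ∈ stanleyReisnerIdeal k K W ↔ F.Nonempty ∧ F ∉ K.faces := by
  rw [stanleyReisnerIdeal_eq_span, sqfreeMonomial_mem_span_iff]
  constructor
  · rintro ⟨G, ⟨-, hG, hGK⟩, hGF⟩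
    exact ⟨hG.mono hGF, fun h => hGK (face_of_subset h hGF hG)⟩
  · rintro ⟨h, hK⟩
    exact ⟨F, ⟨hF, h, hK⟩, subset_rfl⟩

/-- A minimal nonface gives a minimal generator of the Stanley–Reisner ideal. -/
theorem isMinimalGenerator_of_minimal_nonface (K : PreAbstractSimplicialComplex V)
    {W G : Finset V} (hG : Minimal (fun F : Finset V => F ⊆ W ∧ F.Nonempty ∧ F ∉ K.faces) G) :
    IsMinimalGenerator (stanleyReisnerIdeal k K W) (∑ v ∈ G, Finsupp.single v 1) := by
  classical
  unfold IsMinimalGenerator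
  simp only [stanleyReisnerIdeal_eq_span, monomial_mem_span_sqfreeMonomial_iff]
  refine ⟨⟨G, hG.prop, fun v hv => by simp [sum_single_apply, hv]⟩, ?_⟩
  rintro m ⟨H, hH, hHm⟩ hm
  have hHG : H ⊆ G := fun v hv => by
    by_contra hvG
    have := hm v
    rw [sum_single_apply, if_neg hvG] at this
    exact hHm v hv (Nat.le_zero.1 this)
  have hGH := hG.le_of_le hH hHG
  exact (sum_single_le_iff G m).2 fun v hv => hHm v (hGH hv)

/-- If every minimal nonface contains at most one element of `B`, then a set is a face as soon as
all its subsets with at most one element of `B` are. -/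
theorem face_of_forall_insert [DecidableEq V] {K : PreAbstractSimplicialComplex V}
    {A B W : Finset V}
    (hW : ∀ v ∈ W, v ∉ A → v ∈ B)
    (hgen : ∀ m : V →₀ ℕ, IsMinimalGenerator (stanleyReisnerIdeal k K W) m →
      ∀ b₁ ∈ B, ∀ b₂ ∈ B, ¬ ((X b₁ * X b₂ : MvPolynomial V k) ∣ monomial m 1))
    {F : Finset V} (hFW : F ⊆ W) (hF : F.Nonempty)
    (h : ∀ v ∈ F, insert v (F ∩ A) ∈ K.faces) : F ∈ K.faces := by
  by_contra hFK
  obtain ⟨G, hGF, hG⟩ := exists_minimal_le_of_wellFoundedLT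
    (fun F : Finset V => F ⊆ W ∧ F.Nonempty ∧ F ∉ K.faces) F ⟨hFW, hF, hFK⟩
  have hGF : G ⊆ F := hGF
  obtain ⟨hGW, hGn, hGK⟩ := hG.prop
  -- A minimal nonface has at most one vertex outside `A`: two of them would lie in `B`, and their
  -- product would divide a minimal generator.
  have key : ∃ v ∈ F, G ⊆ insert v (F ∩ A) := by
    by_cases hGA : G ⊆ A
    · obtain ⟨v, hv⟩ := hF
      exact ⟨v, hv, fun w hw => Finset.mem_insert_of_mem
        (Finset.mem_inter.2 ⟨hGF hw, hGA hw⟩)⟩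
    · obtain ⟨b, hb, hbA⟩ := Finset.not_subset.1 hGA
      refine ⟨b, hGF hb, fun w hw => ?_⟩
      by_contra hwn
      rw [Finset.mem_insert, Finset.mem_inter, not_or, not_and] at hwn
      refine hgen _ (isMinimalGenerator_of_minimal_nonface K hG) b (hW b (hGW hb) hbA) w
        (hW w (hGW hw) (hwn.2 (hGF hw))) ?_
      rw [← sqfreeMonomial_eq_monomial, sqfreeMonomial]
      rw [← Finset.prod_pair (f := fun v => (X v : MvPolynomial V k)) (Ne.symm hwn.1)]
      exact Finset.prod_dvd_prod_of_subset _ _ _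
        (Finset.insert_subset hb (Finset.singleton_subset_iff.2 hw))
  obtain ⟨v, hv, hGv⟩ := key
  exact hGK (face_of_subset (h v hv) hGv hGn)

theorem face_iff_forall_insert [DecidableEq V] {K : PreAbstractSimplicialComplex V}
    {A B W : Finset V} (hKW : IsOn K W) (hW : ∀ v ∈ W, v ∉ A → v ∈ B)
    (hgen : ∀ m : V →₀ ℕ, IsMinimalGenerator (stanleyReisnerIdeal k K W) m →
      ∀ b₁ ∈ B, ∀ b₂ ∈ B, ¬ ((X b₁ * X b₂ : MvPolynomial V k) ∣ monomial m 1))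
    (F : Finset V) :
    F = ∅ ∨ F ∈ K.faces ↔ ∀ v ∈ F, insert v (F ∩ A) ∈ K.faces := by
  constructor
  · rintro (rfl | hF) v hv
    · simp at hv
    · exact face_of_subset hF (Finset.insert_subset hv Finset.inter_subset_left)
        (Finset.insert_nonempty _ _)
  · intro h
    rcases F.eq_empty_or_nonempty with h0 | h0
    · exact Or.inl h0
    · exact Or.inr (face_of_forall_insert hW hgen
        (fun v hv => hKW _ (h v hv) (Finset.mem_insert_self _ _)) h0 h)

/-- Both tests can be read off the union of the two parts: vertices of the right part lie in `B₀ ∪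
C`, which misses `A`, and those of the left part lie in `A ∪ B`, which misses `C`. -/
theorem mem_join_faces_iff [DecidableEq V] {A B B₀ C : Finset V} (hAB : Disjoint A B)
    (hAC : Disjoint A C) (hBC : Disjoint B C) (hB₀ : B₀ ⊆ B)
    {K L : PreAbstractSimplicialComplex V} (hK : IsOn K (A ∪ B)) (hL : IsOn L (B₀ ∪ C))
    (hgenK : ∀ m : V →₀ ℕ, IsMinimalGenerator (stanleyReisnerIdeal k K (A ∪ B)) m →
      ∀ b₁ ∈ B, ∀ b₂ ∈ B, ¬ ((X b₁ * X b₂ : MvPolynomial V k) ∣ monomial m 1))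
    (hgenL : ∀ m : V →₀ ℕ, IsMinimalGenerator (stanleyReisnerIdeal k L (B₀ ∪ C)) m →
      ∀ b₁ ∈ B, ∀ b₂ ∈ B, ¬ ((X b₁ * X b₂ : MvPolynomial V k) ∣ monomial m 1))
    (S : Finset (V ⊕ V)) :
    S ∈ (join K L).faces ↔ S.Nonempty ∧
      (∀ v ∈ S.toLeft, insert v ((S.toLeft ∪ S.toRight) ∩ A) ∈ K.faces) ∧
      (∀ v ∈ S.toRight, insert v ((S.toLeft ∪ S.toRight) ∩ C) ∈ L.faces) := by
  have h1 := face_iff_forall_insert (A := A) hK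
    (fun v hv hvA => (Finset.mem_union.1 hv).resolve_left hvA) hgenK S.toLeft
  have h2 := face_iff_forall_insert (A := C) hL
    (fun v hv hvC => hB₀ ((Finset.mem_union.1 hv).resolve_right hvC)) hgenL S.toRight
  have hdis : ∀ v, v ∈ B₀ ∪ C → v ∉ A := fun v hv hvA => by
    rcases Finset.mem_union.1 hv with h | h
    · exact Finset.disjoint_left.1 hAB hvA (hB₀ h)
    · exact Finset.disjoint_left.1 hAC hvA h
  have hdis' : ∀ v, v ∈ A ∪ B → v ∉ C := fun v hv hvC => by
    rcases Finset.mem_union.1 hv with h | h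
    · exact Finset.disjoint_left.1 hAC h hvC
    · exact Finset.disjoint_left.1 hBC h hvC
  have hA : (∀ v ∈ S.toRight, v ∈ B₀ ∪ C) →
      (S.toLeft ∪ S.toRight) ∩ A = S.toLeft ∩ A := fun h => by
    rw [Finset.union_inter_distrib_right,
      Finset.disjoint_iff_inter_eq_empty.1 (Finset.disjoint_left.2 fun v hv => hdis v (h v hv)),
      Finset.union_empty]
  have hC : (∀ v ∈ S.toLeft, v ∈ A ∪ B) →
      (S.toLeft ∪ S.toRight) ∩ C = S.toRight ∩ C := fun h => by
    rw [Finset.union_inter_distrib_right,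
      Finset.disjoint_iff_inter_eq_empty.1 (Finset.disjoint_left.2 fun v hv => hdis' v (h v hv)),
      Finset.empty_union]
  change (S.Nonempty ∧ _ ∧ _) ↔ _
  rw [h1, h2]
  refine and_congr_right fun _ => ?_
  constructor
  · rintro ⟨hl, hr⟩
    rw [hA fun v hv => hL _ (hr v hv) (Finset.mem_insert_self _ _),
      hC fun v hv => hK _ (hl v hv) (Finset.mem_insert_self _ _)]
    exact ⟨hl, hr⟩
  · rintro ⟨hl, hr⟩
    rw [hA fun v hv => hL _ (hr v hv) (Finset.mem_insert_self _ _)] at hl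
    rw [hC fun v hv => hK _ (hl v hv) (Finset.mem_insert_self _ _)] at hr
    exact ⟨hl, hr⟩

theorem sqfreeMonomial_mul_X [DecidableEq V] {F : Finset V} {b : V} (hb : b ∉ F) :
    sqfreeMonomial k F * X b = sqfreeMonomial k (insert b F) := by
  rw [sqfreeMonomial, sqfreeMonomial, Finset.prod_insert hb, mul_comm]

theorem sqfreeMonomial_mul [DecidableEq V] {F G : Finset V} (h : Disjoint F G) :
    sqfreeMonomial k F * sqfreeMonomial k G = sqfreeMonomial k (F ∪ G) :=
  (Finset.prod_union h).symm

/-- Disjointness of `A`, `B`, `C` keeps the products squarefree, so that ideal membership becomes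
containment of vertex sets. -/
theorem gluedGenerators_eq_image [DecidableEq V] {A B B₀ C : Finset V} (hAB : Disjoint A B)
    (hAC : Disjoint A C) (hBC : Disjoint B C) (hB₀ : B₀ ⊆ B)
    (K L : PreAbstractSimplicialComplex V) :
    gluedGenerators k A B B₀ C (stanleyReisnerIdeal k K (A ∪ B))
        (stanleyReisnerIdeal k L (B₀ ∪ C)) =
      sqfreeMonomial k ''
        ({a | a ⊆ A ∧ a.Nonempty ∧ a ∉ K.faces} ∪ {c | c ⊆ C ∧ c.Nonempty ∧ c ∉ L.faces} ∪
          {F | ∃ a ⊆ A, ∃ b ∈ B₀, ∃ c ⊆ C, insert b a ∉ K.faces ∧ insert b c ∉ L.faces ∧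
            F = insert b a ∪ c} ∪
          {F | ∃ a ⊆ A, ∃ b ∈ B \ B₀, insert b a ∉ K.faces ∧ F = insert b a}) := by
  have memK : ∀ F ⊆ A ∪ B, (sqfreeMonomial k F ∈ stanleyReisnerIdeal k K (A ∪ B) ↔
      F.Nonempty ∧ F ∉ K.faces) := fun F hF => sqfreeMonomial_mem_stanleyReisnerIdeal_iff K hF
  have memL : ∀ F ⊆ B₀ ∪ C, (sqfreeMonomial k F ∈ stanleyReisnerIdeal k L (B₀ ∪ C) ↔
      F.Nonempty ∧ F ∉ L.faces) := fun F hF => sqfreeMonomial_mem_stanleyReisnerIdeal_iff L hF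
  have hA : ∀ a ⊆ A, ∀ b ∈ B, sqfreeMonomial k a * X b = sqfreeMonomial k (insert b a) ∧
      (sqfreeMonomial k a * X b ∈ stanleyReisnerIdeal k K (A ∪ B) ↔ insert b a ∉ K.faces) :=
    fun a ha b hb => by
      have h := sqfreeMonomial_mul_X (k := k)
        fun h : b ∈ a => Finset.disjoint_left.1 hAB (ha h) hb
      refine ⟨h, ?_⟩
      rw [h, memK _ (Finset.insert_subset (Finset.mem_union_right _ hb)
        (ha.trans Finset.subset_union_left))]
      simp
  have hC : ∀ c ⊆ C, ∀ b ∈ B₀,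
      (X b * sqfreeMonomial k c ∈ stanleyReisnerIdeal k L (B₀ ∪ C) ↔ insert b c ∉ L.faces) :=
    fun c hc b hb => by
      rw [mul_comm, sqfreeMonomial_mul_X (k := k)
        fun h : b ∈ c => Finset.disjoint_left.1 hBC (hB₀ hb) (hc h),
        memL _ (Finset.insert_subset (Finset.mem_union_left _ hb)
        (hc.trans Finset.subset_union_right))]
      simp
  have hABC : ∀ a ⊆ A, ∀ b ∈ B, ∀ c ⊆ C, Disjoint (insert b a) c := fun a ha b hb c hc =>
    Finset.disjoint_insert_left.2 ⟨fun h => Finset.disjoint_left.1 hBC hb (hc h),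
      Finset.disjoint_of_subset_left ha (Finset.disjoint_of_subset_right hc hAC)⟩
  rw [gluedGenerators, Set.image_union, Set.image_union, Set.image_union]
  congr 1
  · congr 1
    · congr 1
      · ext p
        constructor
        · rintro ⟨a, ha, h, rfl⟩
          exact ⟨a, ⟨ha, (memK a (ha.trans Finset.subset_union_left)).1 h⟩, rfl⟩
        · rintro ⟨a, ⟨ha, h⟩, rfl⟩
          exact ⟨a, ha, (memK a (ha.trans Finset.subset_union_left)).2 h, rfl⟩
      · ext p
        constructor
        · rintro ⟨c, hc, h, rfl⟩
          exact ⟨c, ⟨hc, (memL c (hc.trans Finset.subset_union_right)).1 h⟩, rfl⟩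
        · rintro ⟨c, ⟨hc, h⟩, rfl⟩
          exact ⟨c, hc, (memL c (hc.trans Finset.subset_union_right)).2 h, rfl⟩
    · ext p
      constructor
      · rintro ⟨a, ha, b, hb, c, hc, h1, h2, rfl⟩
        refine ⟨_, ⟨a, ha, b, hb, c, hc, (hA a ha b (hB₀ hb)).2.1 h1, (hC c hc b hb).1 h2, rfl⟩, ?_⟩
        rw [(hA a ha b (hB₀ hb)).1, sqfreeMonomial_mul (hABC a ha b (hB₀ hb) c hc)]
      · rintro ⟨_, ⟨a, ha, b, hb, c, hc, h1, h2, rfl⟩, rfl⟩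
        refine ⟨a, ha, b, hb, c, hc, (hA a ha b (hB₀ hb)).2.2 h1, (hC c hc b hb).2 h2, ?_⟩
        rw [(hA a ha b (hB₀ hb)).1, sqfreeMonomial_mul (hABC a ha b (hB₀ hb) c hc)]
  · ext p
    constructor
    · rintro ⟨a, ha, b, hb, h1, rfl⟩
      have hb' := (Finset.mem_sdiff.1 hb).1
      exact ⟨_, ⟨a, ha, b, hb, (hA a ha b hb').2.1 h1, rfl⟩, (hA a ha b hb').1.symm⟩
    · rintro ⟨_, ⟨a, ha, b, hb, h1, rfl⟩, rfl⟩
      have hb' := (Finset.mem_sdiff.1 hb).1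
      exact ⟨a, ha, b, hb, (hA a ha b hb').2.2 h1, (hA a ha b hb').1.symm⟩

/-- A vertex fails both tests exactly when it produces a generator. On `A` the second test fails
automatically, since such a vertex is not in `B₀ ∪ C`; on `C` the first one does, and on `B \ B₀`
the second one. This accounts for the four families. -/
theorem mem_glued_faces_iff [DecidableEq V] {A B B₀ C : Finset V} (hAB : Disjoint A B)
    (hAC : Disjoint A C) (hBC : Disjoint B C) (hB₀ : B₀ ⊆ B)
    {K L Y : PreAbstractSimplicialComplex V} (hK : IsOn K (A ∪ B)) (hL : IsOn L (B₀ ∪ C))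
    (hY : IsOn Y (A ∪ B ∪ C))
    (hglue : stanleyReisnerIdeal k Y (A ∪ B ∪ C) =
      Ideal.span (gluedGenerators k A B B₀ C (stanleyReisnerIdeal k K (A ∪ B))
        (stanleyReisnerIdeal k L (B₀ ∪ C))))
    (F : Finset V) :
    F ∈ Y.faces ↔ F.Nonempty ∧
      ∀ v ∈ F, insert v (F ∩ A) ∈ K.faces ∨ insert v (F ∩ C) ∈ L.faces := by
  by_cases hF : F ⊆ A ∪ B ∪ C
  swap
  · refine iff_of_false (fun h => hF (hY F h)) fun ⟨_, h⟩ => hF fun v hv => ?_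
    rcases h v hv with h | h
    · exact Finset.mem_union_left _ (hK _ h (Finset.mem_insert_self _ _))
    · exact Finset.union_subset_union_left (hB₀.trans Finset.subset_union_right)
        (hL _ h (Finset.mem_insert_self _ _))
  have h1 := sqfreeMonomial_mem_stanleyReisnerIdeal_iff (k := k) Y hF
  rw [hglue, gluedGenerators_eq_image hAB hAC hBC hB₀, sqfreeMonomial_mem_span_iff] at h1
  rcases F.eq_empty_or_nonempty with rfl | hFn
  · exact iff_of_false (fun h => by simpa using face_nonempty h) (by simp)
  rw [← not_iff_not]
  simp only [hFn, true_and] at h1 ⊢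
  rw [← h1]
  push Not
  constructor
  -- The failing vertex is any element of the generator in the first two families, and `b` in the
  -- last two.
  · rintro ⟨G, ((⟨hGA, hGn, hG⟩ | ⟨hGC, hGn, hG⟩) | ⟨a, ha, b, hb, c, hc, h1, h2, rfl⟩) |
      ⟨a, ha, b, hb, h1, rfl⟩, hGF⟩
    · obtain ⟨v, hv⟩ := hGn
      refine ⟨v, hGF hv, fun h => hG (face_of_subset h (fun w hw => ?_) ⟨v, hv⟩), fun h => ?_⟩
      · exact Finset.mem_insert_of_mem (Finset.mem_inter.2 ⟨hGF hw, hGA hw⟩)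
      · rcases Finset.mem_union.1 (hL _ h (Finset.mem_insert_self _ _)) with h | h
        · exact Finset.disjoint_left.1 hAB (hGA hv) (hB₀ h)
        · exact Finset.disjoint_left.1 hAC (hGA hv) h
    · obtain ⟨v, hv⟩ := hGn
      refine ⟨v, hGF hv, fun h => ?_, fun h => hG (face_of_subset h (fun w hw => ?_) ⟨v, hv⟩)⟩
      · rcases Finset.mem_union.1 (hK _ h (Finset.mem_insert_self _ _)) with h | h
        · exact Finset.disjoint_left.1 hAC h (hGC hv)
        · exact Finset.disjoint_left.1 hBC h (hGC hv)
      · exact Finset.mem_insert_of_mem (Finset.mem_inter.2 ⟨hGF hw, hGC hw⟩)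
    · rw [Finset.union_subset_iff, Finset.insert_subset_iff] at hGF
      refine ⟨b, hGF.1.1, fun h => h1 (face_of_subset h ?_ (Finset.insert_nonempty _ _)),
        fun h => h2 (face_of_subset h ?_ (Finset.insert_nonempty _ _))⟩
      · exact Finset.insert_subset_insert _ (Finset.subset_inter hGF.1.2 ha)
      · exact Finset.insert_subset_insert _ (Finset.subset_inter hGF.2 hc)
    · rw [Finset.insert_subset_iff] at hGF
      refine ⟨b, hGF.1, fun h => h1 (face_of_subset h ?_ (Finset.insert_nonempty _ _)),
        fun h => ?_⟩
      · exact Finset.insert_subset_insert _ (Finset.subset_inter hGF.2 ha)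
      · rw [Finset.mem_sdiff] at hb
        rcases Finset.mem_union.1 (hL _ h (Finset.mem_insert_self _ _)) with h | h
        · exact hb.2 h
        · exact Finset.disjoint_left.1 hBC hb.1 h
  · rintro ⟨v, hv, hvK, hvL⟩
    -- For `v` in `A` or `C` the insertion is vacuous in the relevant test; otherwise `v ∈ B`, and
    -- membership in `B₀` decides between the last two families.
    by_cases hvA : v ∈ A
    · rw [Finset.insert_eq_of_mem (Finset.mem_inter.2 ⟨hv, hvA⟩)] at hvK
      exact ⟨F ∩ A, Or.inl (Or.inl (Or.inl ⟨Finset.inter_subset_right,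
        ⟨v, Finset.mem_inter.2 ⟨hv, hvA⟩⟩, hvK⟩)), Finset.inter_subset_left⟩
    by_cases hvC : v ∈ C
    · rw [Finset.insert_eq_of_mem (Finset.mem_inter.2 ⟨hv, hvC⟩)] at hvL
      exact ⟨F ∩ C, Or.inl (Or.inl (Or.inr ⟨Finset.inter_subset_right,
        ⟨v, Finset.mem_inter.2 ⟨hv, hvC⟩⟩, hvL⟩)), Finset.inter_subset_left⟩
    have hvB : v ∈ B := by
      have := hF hv
      simp only [Finset.mem_union] at this
      tauto
    have hins : insert v (F ∩ A) ⊆ F := Finset.insert_subset hv Finset.inter_subset_left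
    by_cases hvB₀ : v ∈ B₀
    · exact ⟨_, Or.inl (Or.inr ⟨F ∩ A, Finset.inter_subset_right, v, hvB₀, F ∩ C,
        Finset.inter_subset_right, hvK, hvL, rfl⟩),
        Finset.union_subset hins Finset.inter_subset_left⟩
    · exact ⟨_, Or.inr ⟨F ∩ A, Finset.inter_subset_right, v, Finset.mem_sdiff.2 ⟨hvB, hvB₀⟩,
        hvK, rfl⟩, hins⟩

end Algebra

/-! ### Truncation, splitting and the homotopy equivalence. -/

section Topology

/-- The set of vertices at which a point has a nonzero coordinate. -/
def coordSupport {V : Type*} [Fintype V] (x : V → ℝ) : Finset V :=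
  letI := Classical.decPred fun v => x v ≠ 0
  Finset.univ.filter fun v => x v ≠ 0

variable {V : Type*} [Fintype V]

@[simp]
theorem mem_coordSupport {x : V → ℝ} {v : V} : v ∈ coordSupport x ↔ x v ≠ 0 := by
  simp [coordSupport]

theorem mem_realization_iff {K : PreAbstractSimplicialComplex V} {x : V → ℝ} :
    x ∈ realization K ↔ x ∈ stdSimplex ℝ V ∧ coordSupport x ∈ K.faces := by
  refine and_congr_right fun _ => ⟨?_, fun h => ⟨_, h, fun v => mem_coordSupport.symm⟩⟩
  rintro ⟨F, hF, h⟩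
  rwa [show coordSupport x = F from Finset.ext fun v => mem_coordSupport.trans (h v)]

theorem coordSupport_nonempty {x : V → ℝ} (hx : x ∈ stdSimplex ℝ V) :
    (coordSupport x).Nonempty := by
  by_contra h
  rw [Finset.not_nonempty_iff_eq_empty] at h
  have h0 : ∀ v, x v = 0 := fun v => by
    by_contra hv
    simpa [h] using mem_coordSupport.2 hv
  simpa [h0] using hx.2

/-- Two maps into a realization are homotopic along straight lines if the segment between any two
corresponding values lies in the realization. -/
theorem homotopic_of_segment {Y : Type*} [TopologicalSpace Y]
    {K : PreAbstractSimplicialComplex V} (f g : C(Y, realization K))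
    (h : ∀ y, segment ℝ (f y : V → ℝ) (g y) ⊆ realization K) : f.Homotopic g := by
  refine ⟨⟨⟨fun p => ⟨(1 - (p.1 : ℝ)) • (f p.2 : V → ℝ) + (p.1 : ℝ) • (g p.2 : V → ℝ),
      h p.2 ⟨1 - p.1, p.1, sub_nonneg.2 p.1.2.2, p.1.2.1, sub_add_cancel _ _, rfl⟩⟩, ?_⟩, ?_, ?_⟩⟩
  · fun_prop
  · intro y; ext v; simp
  · intro y; ext v; simp

theorem segment_subset_realization {K : PreAbstractSimplicialComplex V} {x y : V → ℝ}
    (hx : x ∈ stdSimplex ℝ V) (hy : y ∈ stdSimplex ℝ V)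
    {F : Finset V} (hF : F ∈ K.faces)
    (hxF : coordSupport x ⊆ F) (hyF : coordSupport y ⊆ F) :
    segment ℝ x y ⊆ realization K := by
  intro z hz
  have hzs := (convex_stdSimplex ℝ V).segment_subset hx hy hz
  refine mem_realization_iff.2 ⟨hzs, face_of_subset hF (fun v hv => ?_)
    (coordSupport_nonempty hzs)⟩
  obtain ⟨a, b, -, -, -, rfl⟩ := hz
  by_contra hvF
  have h1 : x v = 0 := by by_contra h; exact hvF (hxF (mem_coordSupport.2 h))
  have h2 : y v = 0 := by by_contra h; exact hvF (hyF (mem_coordSupport.2 h))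
  simp [h1, h2] at hv

/-- The threshold below which coordinates are cut off. -/
def cutoff (V : Type*) [Fintype V] : ℝ := 1 / ((Fintype.card V : ℝ) + 1)

theorem cutoff_pos : 0 < cutoff V := by unfold cutoff; positivity

/-- The total mass left after cutting off small coordinates. -/
def cutMass (x : V → ℝ) : ℝ := ∑ v, max (x v - cutoff V) 0

/-- With `n` vertices, the coordinates sum to 1 while the cutoffs sum to `n / (n + 1) < 1`, so some
mass survives. -/
theorem cutMass_pos {x : V → ℝ} (hx : x ∈ stdSimplex ℝ V) : 0 < cutMass x := by
  have h1 : ∑ v, (x v - cutoff V) ≤ cutMass x :=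
    Finset.sum_le_sum fun v _ => le_max_left _ _
  refine lt_of_lt_of_le ?_ h1
  rw [Finset.sum_sub_distrib, hx.2, Finset.sum_const, Finset.card_univ, nsmul_eq_mul, cutoff,
    sub_pos, mul_one_div, div_lt_one (by positivity)]
  exact lt_add_one _

/-- Cut off the coordinates below the threshold and rescale. -/
def truncate (x : V → ℝ) (v : V) : ℝ := max (x v - cutoff V) 0 / cutMass x

theorem truncate_mem {x : V → ℝ} (hx : x ∈ stdSimplex ℝ V) : truncate x ∈ stdSimplex ℝ V := by
  refine ⟨fun v => div_nonneg (le_max_right _ _) (cutMass_pos hx).le, ?_⟩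
  unfold truncate
  rw [← Finset.sum_div]
  exact div_self (cutMass_pos hx).ne'

theorem truncate_ne_zero_iff {x : V → ℝ} (hx : x ∈ stdSimplex ℝ V) {v : V} :
    truncate x v ≠ 0 ↔ cutoff V < x v := by
  rw [truncate, div_ne_zero_iff, and_iff_left (cutMass_pos hx).ne']
  constructor
  · intro h
    by_contra hle
    exact h (max_eq_right (by linarith))
  · intro h
    rw [max_eq_left (by linarith)]
    linarith

theorem coordSupport_truncate_subset {x : V → ℝ} (hx : x ∈ stdSimplex ℝ V) :
    coordSupport (truncate x) ⊆ coordSupport x := fun v hv => by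
  have := (truncate_ne_zero_iff hx).1 (mem_coordSupport.1 hv)
  exact mem_coordSupport.2 (cutoff_pos.trans this).ne'

theorem continuous_cutMass : Continuous (cutMass : (V → ℝ) → ℝ) := by
  unfold cutMass; fun_prop

theorem continuous_truncate {Y : Type*} [TopologicalSpace Y] {f : Y → V → ℝ} (hf : Continuous f)
    (hs : ∀ y, f y ∈ stdSimplex ℝ V) : Continuous fun y => truncate (f y) := by
  refine continuous_pi fun v => ?_
  unfold truncate
  exact Continuous.div (by fun_prop) (continuous_cutMass.comp hf) fun y => (cutMass_pos (hs y)).ne'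

/-- Add up the weights of the two copies of each vertex. -/
def collapse (y : V ⊕ V → ℝ) (v : V) : ℝ := y (Sum.inl v) + y (Sum.inr v)

theorem collapse_mem {y : V ⊕ V → ℝ} (hy : y ∈ stdSimplex ℝ (V ⊕ V)) :
    collapse y ∈ stdSimplex ℝ V := by
  refine ⟨fun v => add_nonneg (hy.1 _) (hy.1 _), ?_⟩
  have := hy.2
  rw [Fintype.sum_sum_type] at this
  rw [← this]
  exact Finset.sum_add_distrib

theorem coordSupport_collapse [DecidableEq V] {y : V ⊕ V → ℝ} (hy : ∀ i, 0 ≤ y i) :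
    coordSupport (collapse y) = (coordSupport y).toLeft ∪ (coordSupport y).toRight := by
  ext v
  have h := add_eq_zero_iff_of_nonneg (hy (Sum.inl v)) (hy (Sum.inr v))
  simp only [mem_coordSupport, Finset.mem_union, Finset.mem_toLeft, Finset.mem_toRight, collapse,
    Ne, h]
  tauto

/-- Divide the weight of each vertex between its two copies, in the ratio `c v` to `1 - c v`. -/
def split (c x : V → ℝ) : V ⊕ V → ℝ :=
  Sum.elim (fun v => c v * x v) (fun v => (1 - c v) * x v)

theorem collapse_split {V : Type*} (c x : V → ℝ) : collapse (split c x) = x := by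
  ext v; simp only [collapse, split, Sum.elim_inl, Sum.elim_inr]; ring

theorem split_mem {c x : V → ℝ} (hc : ∀ v, c v ∈ Set.Icc (0 : ℝ) 1) (hx : x ∈ stdSimplex ℝ V) :
    split c x ∈ stdSimplex ℝ (V ⊕ V) := by
  refine ⟨?_, ?_⟩
  · rintro (v | v)
    · exact mul_nonneg (hc v).1 (hx.1 v)
    · exact mul_nonneg (sub_nonneg.2 (hc v).2) (hx.1 v)
  · have := congrArg (fun z : V → ℝ => ∑ v, z v) (collapse_split c x)
    simp only [collapse, hx.2, Finset.sum_add_distrib] at this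
    rwa [Fintype.sum_sum_type]

/-- The share of the first copy in the weight of a vertex, wherever the latter is at least the
threshold. -/
def share (y : V ⊕ V → ℝ) (v : V) : ℝ := y (Sum.inl v) / max (collapse y v) (cutoff V)

theorem share_mem {y : V ⊕ V → ℝ} (hy : ∀ i, 0 ≤ y i) (v : V) :
    share y v ∈ Set.Icc (0 : ℝ) 1 := by
  have hpos : 0 < max (collapse y v) (cutoff V) := lt_max_of_lt_right cutoff_pos
  refine ⟨div_nonneg (hy _) hpos.le, (div_le_one hpos).2 (le_max_of_le_left ?_)⟩
  exact le_add_of_nonneg_right (hy _)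

/-- A complex `J` on two copies of `V` whose faces are the ways of distributing the vertices of the
faces of `Y` over the two copies, subject to the conditions `P` and `Q` on the underlying set, has
the homotopy type of `Y`. -/
theorem nonempty_homotopyEquiv_of_split [DecidableEq V] (P Q : V → Finset V → Prop)
    (hP : ∀ v F G, F ⊆ G → P v G → P v F) (hQ : ∀ v F G, F ⊆ G → Q v G → Q v F)
    (Y : PreAbstractSimplicialComplex V) (J : PreAbstractSimplicialComplex (V ⊕ V))
    (hY : ∀ F, F ∈ Y.faces ↔ F.Nonempty ∧ ∀ v ∈ F, P v F ∨ Q v F)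
    (hJ : ∀ S, S ∈ J.faces ↔ S.Nonempty ∧ (∀ v ∈ S.toLeft, P v (S.toLeft ∪ S.toRight)) ∧
      (∀ v ∈ S.toRight, Q v (S.toLeft ∪ S.toRight))) :
    Nonempty (realization J ≃ₕ realization Y) := by
  classical
  -- the closed sets on which all weight of a vertex has to go to one copy
  let big : (V → ℝ) → Finset V := fun x => Finset.univ.filter fun v => cutoff V ≤ x v
  have hclosed : ∀ R : Finset V → Prop, (∀ F G, F ⊆ G → R G → R F) → ∀ v : V,
      IsClosed {x : realization Y | cutoff V ≤ (x : V → ℝ) v ∧ ¬ R (big x)} := by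
    intro R hR v
    -- Failure of `R` passes to larger sets, so it amounts to all coordinates of some failing `F`
    -- reaching the cutoff: a finite union of closed sets.
    have : {x : realization Y | cutoff V ≤ (x : V → ℝ) v ∧ ¬ R (big x)} =
        {x : realization Y | cutoff V ≤ (x : V → ℝ) v} ∩
        ⋃ F ∈ {F : Finset V | ¬ R F}, ⋂ w ∈ F, {x : realization Y | cutoff V ≤ (x : V → ℝ) w} := by
      ext x
      simp only [Set.mem_ofPred_eq, Set.mem_inter_iff, Set.mem_iUnion, Set.mem_iInter]
      refine and_congr_right fun _ => ⟨fun h => ⟨_, h, fun w hw => (Finset.mem_filter.1 hw).2⟩, ?_⟩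
      rintro ⟨F, hF, h⟩ hb
      exact hF (hR _ _ (fun w hw => Finset.mem_filter.2 ⟨Finset.mem_univ _, h w hw⟩) hb)
    rw [this]
    have hc : ∀ w : V, IsClosed {x : realization Y | cutoff V ≤ (x : V → ℝ) w} := fun w =>
      isClosed_le continuous_const ((continuous_apply w).comp continuous_subtype_val)
    exact (hc v).inter ((Set.toFinite _).isClosed_biUnion fun F _ =>
      isClosed_biInter fun w _ => hc w)
  have hmem : ∀ x : realization Y, (x : V → ℝ) ∈ stdSimplex ℝ V := fun x => x.2.1
  have hmemJ : ∀ y : realization J, (y : V ⊕ V → ℝ) ∈ stdSimplex ℝ (V ⊕ V) := fun y => y.2.1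
  have hbig : ∀ x : realization Y, big x ⊆ coordSupport (x : V → ℝ) := fun x v hv =>
    mem_coordSupport.2 (cutoff_pos.trans_le (Finset.mem_filter.1 hv).2).ne'
  have htr : ∀ x : realization Y, coordSupport (truncate (x : V → ℝ)) ⊆ big x := fun x v hv =>
    Finset.mem_filter.2 ⟨Finset.mem_univ _,
      ((truncate_ne_zero_iff (hmem x)).1 (mem_coordSupport.1 hv)).le⟩
  have hfaceY : ∀ x : realization Y, ∀ v ∈ coordSupport (x : V → ℝ),
      P v (coordSupport (x : V → ℝ)) ∨ Q v (coordSupport (x : V → ℝ)) := fun x =>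
    ((hY _).1 (mem_realization_iff.1 x.2).2).2
  -- The Urysohn function is the left share of `v`: 0 where `P` fails, 1 where `Q` fails. The two
  -- sets are disjoint because each vertex in the support passes `P` or `Q`.
  have hury : ∀ v : V, ∃ c : C(realization Y, ℝ),
      Set.EqOn c 0 {x | cutoff V ≤ (x : V → ℝ) v ∧ ¬ P v (big x)} ∧
      Set.EqOn c 1 {x | cutoff V ≤ (x : V → ℝ) v ∧ ¬ Q v (big x)} ∧
      ∀ x, c x ∈ Set.Icc (0 : ℝ) 1 := fun v => by
    refine exists_continuous_zero_one_of_isClosed (hclosed _ (hP v) v) (hclosed _ (hQ v) v) ?_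
    rw [Set.disjoint_left]
    rintro x ⟨hx, hxP⟩ ⟨-, hxQ⟩
    rcases hfaceY x v (mem_coordSupport.2 (cutoff_pos.trans_le hx).ne') with h | h
    · exact hxP (hP v _ _ (hbig x) h)
    · exact hxQ (hQ v _ _ (hbig x) h)
  choose c hc0 hc1 hc using hury
  have hcol : ∀ y : realization J, coordSupport (collapse (y : V ⊕ V → ℝ)) =
      (coordSupport (y : V ⊕ V → ℝ)).toLeft ∪ (coordSupport (y : V ⊕ V → ℝ)).toRight := fun y =>
    coordSupport_collapse (hmemJ y).1
  have hfaceJ : ∀ y : realization J,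
      (∀ v ∈ (coordSupport (y : V ⊕ V → ℝ)).toLeft, P v (coordSupport (collapse y))) ∧
      (∀ v ∈ (coordSupport (y : V ⊕ V → ℝ)).toRight, Q v (coordSupport (collapse y))) :=
    fun y => by
      rw [hcol]
      exact ((hJ _).1 (mem_realization_iff.1 y.2).2).2
  -- the segment between two points over the same point of the base
  have hseg : ∀ y z : V ⊕ V → ℝ, y ∈ stdSimplex ℝ (V ⊕ V) → z ∈ stdSimplex ℝ (V ⊕ V) →
      coordSupport (collapse z) ⊆ coordSupport (collapse y) →
      (∀ v, y (Sum.inl v) ≠ 0 ∨ z (Sum.inl v) ≠ 0 → P v (coordSupport (collapse y))) →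
      (∀ v, y (Sum.inr v) ≠ 0 ∨ z (Sum.inr v) ≠ 0 → Q v (coordSupport (collapse y))) →
      segment ℝ y z ⊆ realization J := by
    intro y z hy hz hzy hl hr
    refine segment_subset_realization (F := coordSupport y ∪ coordSupport z) hy hz ((hJ _).2
      ⟨(coordSupport_nonempty hy).mono Finset.subset_union_left, ?_⟩)
      Finset.subset_union_left Finset.subset_union_right
    have hu : (coordSupport y ∪ coordSupport z).toLeft ∪ (coordSupport y ∪ coordSupport z).toRight
        = coordSupport (collapse y) := by
      rw [← Finset.union_eq_left.2 hzy, coordSupport_collapse hy.1, coordSupport_collapse hz.1]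
      ext v
      simp only [Finset.mem_union, Finset.mem_toLeft, Finset.mem_toRight]
      tauto
    rw [hu]
    constructor
    · intro v hv
      refine hl v ?_
      simpa [Finset.mem_toLeft] using hv
    · intro v hv
      refine hr v ?_
      simpa [Finset.mem_toRight] using hv
  -- the map collapsing the two copies
  have hfmem : ∀ y : realization J, collapse (y : V ⊕ V → ℝ) ∈ realization Y := fun y => by
    have hs := collapse_mem (hmemJ y)
    refine mem_realization_iff.2 ⟨hs, (hY _).2 ⟨coordSupport_nonempty hs, fun v hv => ?_⟩⟩
    rw [hcol, Finset.mem_union] at hv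
    exact hv.imp ((hfaceJ y).1 v) ((hfaceJ y).2 v)
  have hcoord : ∀ i, Continuous fun y : realization J => (y : V ⊕ V → ℝ) i := fun i =>
    (continuous_apply i).comp continuous_subtype_val
  let f : C(realization J, realization Y) := ⟨fun y => ⟨collapse y, hfmem y⟩,
    Continuous.subtype_mk (continuous_pi fun v => (hcoord _).add (hcoord _)) _⟩
  -- the map in the other direction
  have hPg : ∀ (x : realization Y) (v : V), c v x * truncate (x : V → ℝ) v ≠ 0 →
      P v (coordSupport (truncate (x : V → ℝ))) := fun x v h => by
    -- The closed sets use `cutoff ≤ x v`, while truncation keeps only `cutoff < x v`; hence the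
    -- truncated support lies in `big x`, and monotonicity applies.
    refine hP v _ _ (htr x) ?_
    by_contra hn
    exact (mul_ne_zero_iff.1 h).1
      (hc0 v ⟨((truncate_ne_zero_iff (hmem x)).1 (mul_ne_zero_iff.1 h).2).le, hn⟩)
  have hQg : ∀ (x : realization Y) (v : V), (1 - c v x) * truncate (x : V → ℝ) v ≠ 0 →
      Q v (coordSupport (truncate (x : V → ℝ))) := fun x v h => by
    refine hQ v _ _ (htr x) ?_
    by_contra hn
    refine (mul_ne_zero_iff.1 h).1 (sub_eq_zero.2 (Eq.symm ?_))
    exact hc1 v ⟨((truncate_ne_zero_iff (hmem x)).1 (mul_ne_zero_iff.1 h).2).le, hn⟩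
  have hgs : ∀ x : realization Y,
      split (fun v => c v x) (truncate (x : V → ℝ)) ∈ stdSimplex ℝ (V ⊕ V) := fun x =>
    split_mem (fun v => hc v x) (truncate_mem (hmem x))
  have hsplit : Continuous fun p : (V → ℝ) × (V → ℝ) => split p.1 p.2 :=
    continuous_pi fun i => by
      rcases i with v | v
      · exact ((continuous_apply v).comp continuous_fst).mul
          ((continuous_apply v).comp continuous_snd)
      · exact (continuous_const.sub ((continuous_apply v).comp continuous_fst)).mul
          ((continuous_apply v).comp continuous_snd)
  have hgmem : ∀ x : realization Y,
      split (fun v => c v x) (truncate (x : V → ℝ)) ∈ realization J := fun x => by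
    -- Membership of a single point, obtained from a degenerate segment.
    refine hseg _ _ (hgs x) (hgs x) subset_rfl ?_ ?_ (left_mem_segment ℝ _ _)
    · intro v hv
      rw [collapse_split]
      exact hPg x v (or_self_iff.1 hv)
    · intro v hv
      rw [collapse_split]
      exact hQg x v (or_self_iff.1 hv)
  let g : C(realization Y, realization J) :=
    ⟨fun x => ⟨split (fun v => c v x) (truncate (x : V → ℝ)), hgmem x⟩,
      Continuous.subtype_mk (hsplit.comp
        ((continuous_pi fun v => (c v).continuous).prodMk
          (continuous_truncate continuous_subtype_val hmem))) _⟩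
  -- the lift of the truncation to `J`
  have hhs : ∀ y : realization J, split (share (y : V ⊕ V → ℝ)) (truncate (collapse y)) ∈
      stdSimplex ℝ (V ⊕ V) := fun y =>
    split_mem (share_mem (hmemJ y).1) (truncate_mem (collapse_mem (hmemJ y)))
  have hshareP : ∀ (y : realization J) (v : V),
      share (y : V ⊕ V → ℝ) v * truncate (collapse (y : V ⊕ V → ℝ)) v ≠ 0 →
      P v (coordSupport (collapse (y : V ⊕ V → ℝ))) := fun y v h => by
    refine (hfaceJ y).1 v (Finset.mem_toLeft.2 (mem_coordSupport.2 fun h0 => h ?_))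
    rw [share, h0, zero_div, zero_mul]
  have hshareQ : ∀ (y : realization J) (v : V),
      (1 - share (y : V ⊕ V → ℝ) v) * truncate (collapse (y : V ⊕ V → ℝ)) v ≠ 0 →
      Q v (coordSupport (collapse (y : V ⊕ V → ℝ))) := fun y v h => by
    refine (hfaceJ y).2 v (Finset.mem_toRight.2 (mem_coordSupport.2 fun h0 => ?_))
    have hlt := (truncate_ne_zero_iff (collapse_mem (hmemJ y))).1 (mul_ne_zero_iff.1 h).2
    refine (mul_ne_zero_iff.1 h).1 (sub_eq_zero.2 (Eq.symm ?_))
    -- Above the cutoff the maximum is the total weight itself; if the right weight vanishes, the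
    -- left share is 1.
    rw [share, max_eq_left hlt.le, collapse, h0, add_zero]
    refine div_self ?_
    rw [collapse, h0, add_zero] at hlt
    exact (cutoff_pos.trans hlt).ne'
  have hsub : ∀ y : realization J, coordSupport (truncate (collapse (y : V ⊕ V → ℝ))) ⊆
      coordSupport (collapse (y : V ⊕ V → ℝ)) := fun y =>
    coordSupport_truncate_subset (collapse_mem (hmemJ y))
  have hyseg : ∀ y : realization J, segment ℝ (y : V ⊕ V → ℝ)
      (split (share (y : V ⊕ V → ℝ)) (truncate (collapse y))) ⊆ realization J := fun y => by
    refine hseg _ _ (hmemJ y) (hhs y) ?_ ?_ ?_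
    · rw [collapse_split]
      exact hsub y
    · rintro v (h | h)
      · exact (hfaceJ y).1 v (Finset.mem_toLeft.2 (mem_coordSupport.2 h))
      · exact hshareP y v h
    · rintro v (h | h)
      · exact (hfaceJ y).2 v (Finset.mem_toRight.2 (mem_coordSupport.2 h))
      · exact hshareQ y v h
  have hshare : Continuous fun y : realization J => share (y : V ⊕ V → ℝ) :=
    continuous_pi fun v => by
      unfold share collapse
      -- The cutoff in the denominator keeps the share continuous where the total weight vanishes.
      exact (hcoord _).div (((hcoord _).add (hcoord _)).max continuous_const) fun y =>
        (lt_max_of_lt_right cutoff_pos).ne'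
  let h : C(realization J, realization J) :=
    ⟨fun y => ⟨split (share (y : V ⊕ V → ℝ)) (truncate (collapse y)),
      hyseg y (right_mem_segment ℝ _ _)⟩,
      Continuous.subtype_mk (hsplit.comp (hshare.prodMk
        (continuous_truncate (continuous_subtype_val.comp f.continuous)
          fun y => collapse_mem (hmemJ y)))) _⟩
  have h1 : (ContinuousMap.id _).Homotopic h := homotopic_of_segment _ _ hyseg
  -- `g ∘ f` obeys the constraints only for the truncated support, so it need not share a face with
  -- the identity. The map `h` keeps the original shares, hence is compatible with the identity, and
  -- lies over the same truncated point as `g ∘ f`.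
  have h2 : (g.comp f).Homotopic h := homotopic_of_segment _ _ fun y => by
    have hgf : collapse ((g.comp f) y : V ⊕ V → ℝ) = truncate (collapse (y : V ⊕ V → ℝ)) :=
      collapse_split _ _
    have hh : collapse (h y : V ⊕ V → ℝ) = truncate (collapse (y : V ⊕ V → ℝ)) :=
      collapse_split _ _
    refine hseg _ _ (hgs (f y)) (hhs y) ?_ ?_ ?_
    · rw [hgf, hh]
    · rw [hgf]
      rintro v (h | h)
      · exact hPg (f y) v h
      · exact hP v _ _ (hsub y) (hshareP y v h)
    · rw [hgf]
      rintro v (h | h)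
      · exact hQg (f y) v h
      · exact hQ v _ _ (hsub y) (hshareQ y v h)
  -- `f ∘ g` is truncation, which never enlarges the support.
  refine ⟨⟨f, g, h2.trans h1.symm, homotopic_of_segment _ _ fun x => ?_⟩⟩
  have hfg : ((f.comp g) x : V → ℝ) = truncate (x : V → ℝ) := collapse_split _ _
  rw [hfg]
  exact segment_subset_realization (truncate_mem (hmem x)) (hmem x) (mem_realization_iff.1 x.2).2
    (coordSupport_truncate_subset (hmem x)) subset_rfl

end Topology

end TowerJoin

end

theorem mainTheorem3 (k : Type*) [Field k] {V : Type*} [Fintype V] [DecidableEq V]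
    (A B B₀ C : Finset V) (hAB : Disjoint A B) (hAC : Disjoint A C) (hBC : Disjoint B C)
    (hB₀ : B₀ ⊆ B)
    (XAB XB₀C X : PreAbstractSimplicialComplex V)
    (hXAB : TowerJoin.IsOn XAB (A ∪ B)) (hXB₀C : TowerJoin.IsOn XB₀C (B₀ ∪ C))
    (hX : TowerJoin.IsOn X (A ∪ B ∪ C))
    (hgenAB : ∀ m : V →₀ ℕ,
      TowerJoin.IsMinimalGenerator (TowerJoin.stanleyReisnerIdeal k XAB (A ∪ B)) m →
        ∀ b₁ ∈ B, ∀ b₂ ∈ B,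
          ¬ ((MvPolynomial.X b₁ * MvPolynomial.X b₂ : MvPolynomial V k) ∣
            MvPolynomial.monomial m 1))
    (hgenB₀C : ∀ m : V →₀ ℕ,
      TowerJoin.IsMinimalGenerator (TowerJoin.stanleyReisnerIdeal k XB₀C (B₀ ∪ C)) m →
        ∀ b₁ ∈ B, ∀ b₂ ∈ B,
          ¬ ((MvPolynomial.X b₁ * MvPolynomial.X b₂ : MvPolynomial V k) ∣
            MvPolynomial.monomial m 1))
    (hglue : TowerJoin.stanleyReisnerIdeal k X (A ∪ B ∪ C) =
      Ideal.span (TowerJoin.gluedGenerators k A B B₀ C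
        (TowerJoin.stanleyReisnerIdeal k XAB (A ∪ B))
        (TowerJoin.stanleyReisnerIdeal k XB₀C (B₀ ∪ C)))) :
    Nonempty (TowerJoin.realization (TowerJoin.join XAB XB₀C) ≃ₕ TowerJoin.realization X) := by
  exact TowerJoin.nonempty_homotopyEquiv_of_split
    (fun v F => insert v (F ∩ A) ∈ XAB.faces) (fun v F => insert v (F ∩ C) ∈ XB₀C.faces)
    (fun v F G hFG h => TowerJoin.face_of_subset h
      (Finset.insert_subset_insert _ (Finset.inter_subset_inter_right hFG))
      (Finset.insert_nonempty _ _))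
    (fun v F G hFG h => TowerJoin.face_of_subset h
      (Finset.insert_subset_insert _ (Finset.inter_subset_inter_right hFG))
      (Finset.insert_nonempty _ _)) X (TowerJoin.join XAB XB₀C)
    (TowerJoin.mem_glued_faces_iff hAB hAC hBC hB₀ hXAB hXB₀C hX hglue)
    (TowerJoin.mem_join_faces_iff hAB hAC hBC hB₀ hXAB hXB₀C hgenAB hgenB₀C)
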